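/- Let $P(4)=\mathbb P(\mathrm{Sym}^4V)$ be the complex projective space of nonzero binary quartic forms $$F=\sum_{i=0}^4\binom4i a_i\,t_0^{4-i}t_1^i ,$$ where $V$ is the space of complex linear forms in $t_0,t_1$, with homogeneous coordinates $(a_0:\dots:a_4)$. Let $X_4\subset P(4)$ be the rational normal (Veronese) quartic curve, i.e. the image of $\mathbb P(V)\to P(4)$, $[v]\mapsto[v^4]$, and let $\bar T\subset P(4)$ be its tangential surface, the union of all (embedded projective) tangent lines of $X_4$. Put $$Q=a_0a_4-4a_1a_3+3a_2^2,\qquad C=a_0a_2a_4-a_0a_3^2+2a_1a_2a_3-a_1^2a_4-a_2^3,\qquad D=Q^3-27C^2 .$$ Then $\bar T=(C=0)\cap(Q=0)$, and the intersection is generically transverse: the points of the intersection at which both hypersurfaces are smooth and their tangent spaces together span the tangent space of $P(4)$ are Zariski dense in the intersection. In particular, the base locus (the set of common zeros of all members) of the pencil of sextics defining the rational function $\jmath=Q^3/D$, namely the pencil spanned by $Q^3$ and $D$ or, equivalently, by $Q^3$ and $C^2$, is $\bar T$. -/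

import Mathlib

open MvPolynomial

noncomputable section

namespace BinaryQuartic

/-- Binary forms of degree `r`: homogeneous polynomials of degree `r` in two variables `t₀, t₁`
over `ℂ`, i.e. `Sym^r V` for `V` the space of linear forms with basis `t₀, t₁`. -/
abbrev Form (r : ℕ) : Type := homogeneousSubmodule (Fin 2) ℂ r

/-- The projective space `P(r)` of binary forms of degree `r`. -/
abbrev P (r : ℕ) : Type := Projectivization ℂ (Form r)

/-- The `r`-th power of a linear form. -/
def formPow (r : ℕ) (v : Form 1) : Form r :=
  ⟨(v : MvPolynomial (Fin 2) ℂ) ^ r, by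
    have h := ((mem_homogeneousSubmodule 1 _).1 v.2).pow r
    rw [one_mul] at h
    exact (mem_homogeneousSubmodule r _).2 h⟩

theorem formPow_ne_zero (r : ℕ) {v : Form 1} (hv : v ≠ 0) : formPow r v ≠ 0 := by
  intro h
  apply hv
  have h' : (v : MvPolynomial (Fin 2) ℂ) ^ r = 0 := congrArg Subtype.val h
  exact Subtype.ext (eq_zero_of_pow_eq_zero h')

/-- The Veronese map `P(1) → P(r)`, `[v] ↦ [v ^ r]`. -/
def veronese (r : ℕ) : P 1 → P r :=
  Projectivization.lift
    (fun v : { v : Form 1 // v ≠ 0 } => Projectivization.mk ℂ (formPow r v) (formPow_ne_zero r v.2))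
    (by
      intro a b t hab
      refine (Projectivization.mk_eq_mk_iff' ℂ _ _ _ _).2 ⟨t ^ r, ?_⟩
      apply Subtype.ext
      have hab' : ((a : Form 1) : MvPolynomial (Fin 2) ℂ) = t • ((b : Form 1) : MvPolynomial (Fin 2) ℂ) :=
        congrArg Subtype.val hab
      simp only [formPow, Submodule.coe_smul, hab', smul_pow])

/-- The Veronese curve `X_r ⊆ P(r)`. -/
def veroneseCurve (r : ℕ) : Set (P r) := Set.range (veronese r)

/-- The coordinates `a₀, …, a₄` of a binary quartic `F`, normalised by
`F = ∑ i, (4 choose i) * a i * t₀ ^ (4 - i) * t₁ ^ i`. -/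
def coord : Form 4 →ₗ[ℂ] (Fin 5 → ℂ) :=
  LinearMap.pi fun i : Fin 5 =>
    ((Nat.choose 4 i : ℂ)⁻¹) •
      (lcoeff ℂ (Finsupp.single (0 : Fin 2) (4 - (i : ℕ)) + Finsupp.single 1 (i : ℕ))
        ∘ₗ (homogeneousSubmodule (Fin 2) ℂ 4).subtype)

/-- Vanishing of a polynomial in `a₀, …, a₄` at a point of `P(4)`. It is used for homogeneous
polynomials only, where it does not depend on the representative of the point. -/
def VanishesAt (f : MvPolynomial (Fin 5) ℂ) (x : P 4) : Prop :=
  eval (coord x.rep) f = 0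

/-- The hypersurface `(f = 0)` in `P(4)`. -/
def zeroLocus (f : MvPolynomial (Fin 5) ℂ) : Set (P 4) := {x | VanishesAt f x}

/-- The differential of `f` at (a representative of) `x`, a linear form on the space of binary
quartics. For homogeneous `f`, its kernel does not depend on the representative. -/
def differential (f : MvPolynomial (Fin 5) ℂ) (x : P 4) : Form 4 →ₗ[ℂ] ℂ :=
  ∑ i : Fin 5, eval (coord x.rep) (pderiv i f) • (LinearMap.proj i ∘ₗ coord)

/-- The embedded projective tangent space at `x` of a subset `Z` of `P(4)`: the points annihilated
by the differentials at `x` of all homogeneous polynomials that vanish on `Z`. -/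
def tangentSpaceAt (Z : Set (P 4)) (x : P 4) : Set (P 4) :=
  {y | ∀ (d : ℕ) (f : MvPolynomial (Fin 5) ℂ), f.IsHomogeneous d → (∀ z ∈ Z, VanishesAt f z) →
    differential f x y.rep = 0}

/-- The tangential surface of the Veronese curve `X₄`: the union of its tangent lines. -/
def tangentialSurface : Set (P 4) :=
  ⋃ x ∈ veroneseCurve 4, tangentSpaceAt (veroneseCurve 4) x

/-- The closure of a subset of `P(4)` in the Zariski topology. -/
def zariskiClosure (S : Set (P 4)) : Set (P 4) :=
  {x | ∀ (d : ℕ) (f : MvPolynomial (Fin 5) ℂ), f.IsHomogeneous d → (∀ z ∈ S, VanishesAt f z) →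
    VanishesAt f x}

/-- The hypersurfaces `(f = 0)` and `(g = 0)` meet transversely at `x`: both contain `x`, both are
smooth there, and their tangent spaces at `x` together span the tangent space of `P(4)`.
(Tangent spaces are given by their preimages in the space of quartics; the preimages contain the
line `x`, by Euler's relation.) -/
def TransverseAt (f g : MvPolynomial (Fin 5) ℂ) (x : P 4) : Prop :=
  VanishesAt f x ∧ VanishesAt g x ∧ differential f x ≠ 0 ∧ differential g x ≠ 0 ∧
    LinearMap.ker (differential f x) ⊔ LinearMap.ker (differential g x) = ⊤

/-- The intersection of `(f = 0)` and `(g = 0)` is generically transverse: the points of transverse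
intersection (a relatively open subset) are Zariski dense in the intersection. Equivalently,
every irreducible component of the intersection contains such a point. -/
def GenericallyTransverse (f g : MvPolynomial (Fin 5) ℂ) : Prop :=
  zeroLocus f ∩ zeroLocus g ⊆ zariskiClosure {x | TransverseAt f g x}

/-- The invariant quadric `Q = a₀a₄ - 4a₁a₃ + 3a₂²`. -/
def quadric : MvPolynomial (Fin 5) ℂ :=
  X 0 * X 4 - 4 * X 1 * X 3 + 3 * X 2 ^ 2

/-- The catalecticant cubic `C = a₀a₂a₄ - a₀a₃² + 2a₁a₂a₃ - a₁²a₄ - a₂³`. -/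
def catalecticant : MvPolynomial (Fin 5) ℂ :=
  X 0 * X 2 * X 4 - X 0 * X 3 ^ 2 + 2 * X 1 * X 2 * X 3 - X 1 ^ 2 * X 4 - X 2 ^ 3

/-- The discriminant `D = Q³ - 27C²`. -/
def discriminant : MvPolynomial (Fin 5) ℂ :=
  quadric ^ 3 - 27 * catalecticant ^ 2

/-- The pencil of sextics defining the rational map `j = Q³ / D` to the projective line. -/
def jPencil : Submodule ℂ (MvPolynomial (Fin 5) ℂ) :=
  Submodule.span ℂ {quadric ^ 3, discriminant}

/-- The base locus of a linear system of hypersurfaces: the common zeros of its members. -/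
def baseLocus (L : Submodule ℂ (MvPolynomial (Fin 5) ℂ)) : Set (P 4) :=
  {x | ∀ f ∈ L, VanishesAt f x}

end BinaryQuartic

end

namespace BinaryQuartic

open MvPolynomial

/-! Differentiating `(v + t w)^4` at `t = 0` shows that the tangent line of the Veronese curve at
`v^4` consists of the quartics `v^3 w`, so the tangential surface is the locus of quartics with a
triple root; `tangentCoord` gives the coordinates of `4 v^3 w`. Three facts carry the proof.

A quartic with `C = Q = 0` has a triple root (`exists_eq_tangentCoord`): once depressed, it lies on
a cuspidal cubic, whose parametrization displays the root.

The embedded tangent space at `v^4` is this line. The differentials of some quadrics through the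
curve bound it from above (`tangentialSurface_subset`); the chain rule along `(v + t w)^4` shows
that it contains every `v^3 w` (`sum_pderiv_tangentCoord_eq_zero`).

The surface is the image of the irreducible affine 4-space of pairs `(v, w)`. A Jacobian minor of
`(C, Q)` is not identically zero there, so a form vanishing at all transverse points vanishes on the
whole surface (`eval_tangentCoord_eq_zero`).

The base locus is then formal: 27 is invertible, and powers do not change zero sets. -/

/-! ### Coordinates, homogeneity and differentials -/

/-- The linear form `α t₀ + β t₁`. -/
noncomputable def linearForm (α β : ℂ) : Form 1 :=
  ⟨C α * X 0 + C β * X 1, (mem_homogeneousSubmodule _ _).2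
    ((isHomogeneous_C_mul_X α 0).add (isHomogeneous_C_mul_X β 1))⟩

/-- The quartic form with prescribed coordinates. -/
noncomputable def ofCoord (a : Fin 5 → ℂ) : Form 4 :=
  ⟨∑ i : Fin 5, monomial (Finsupp.single (0 : Fin 2) (4 - (i : ℕ)) + Finsupp.single 1 (i : ℕ))
      ((Nat.choose 4 i : ℂ) * a i), (mem_homogeneousSubmodule _ _).2 (by
    refine IsHomogeneous.sum _ _ _ fun i _ => isHomogeneous_monomial _ ?_
    have := i.2
    simp only [map_add, Finsupp.degree_single]
    omega)⟩

theorem coord_ofCoord (a : Fin 5 → ℂ) : coord (ofCoord a) = a := by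
  funext i
  have hne : ((Nat.choose 4 i : ℕ) : ℂ) ≠ 0 :=
    Nat.cast_ne_zero.2 (Nat.choose_pos (by omega)).ne'
  have hinj : ∀ j : Fin 5,
      (Finsupp.single (0 : Fin 2) (4 - (j : ℕ)) + Finsupp.single 1 (j : ℕ) =
        Finsupp.single (0 : Fin 2) (4 - (i : ℕ)) + Finsupp.single 1 (i : ℕ)) ↔ j = i := by
    intro j
    refine ⟨fun h => ?_, fun h => h ▸ rfl⟩
    have := DFunLike.congr_fun h 1
    simp at this
    exact Fin.ext this
  simp only [coord, ofCoord, LinearMap.pi_apply, LinearMap.smul_apply, LinearMap.comp_apply,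
    Submodule.subtype_apply, lcoeff_apply, coeff_sum, coeff_monomial, hinj, Finset.sum_ite_eq',
    Finset.mem_univ, if_true, smul_eq_mul]
  field_simp

theorem exists_eq_linearForm (v : Form 1) : ∃ α β : ℂ, v = linearForm α β := by
  refine ⟨coeff (Finsupp.single 0 1) (v : MvPolynomial (Fin 2) ℂ),
    coeff (Finsupp.single 1 1) (v : MvPolynomial (Fin 2) ℂ), Subtype.ext ?_⟩
  have hv : (v : MvPolynomial (Fin 2) ℂ).IsHomogeneous 1 := (mem_homogeneousSubmodule _ _).1 v.2
  ext d
  by_cases hd : d.degree = 1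
  · obtain ⟨i, rfl⟩ : ∃ i, d = Finsupp.single i 1 := by
      rw [Finsupp.degree_eq_sum, Fin.sum_univ_two] at hd
      by_cases h0 : d 0 = 0
      · refine ⟨1, ?_⟩
        ext j
        fin_cases j <;> simp <;> omega
      · refine ⟨0, ?_⟩
        ext j
        fin_cases j <;> simp <;> omega
    fin_cases i <;> simp [linearForm, coeff_C_mul, coeff_X, Finsupp.single_left_inj]
  · rw [hv.coeff_eq_zero hd]
    exact (((mem_homogeneousSubmodule _ _).1
      (linearForm _ _).2 : IsHomogeneous _ 1).coeff_eq_zero hd).symm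

theorem linearForm_ne_zero {α β : ℂ} : linearForm α β ≠ 0 ↔ α ≠ 0 ∨ β ≠ 0 := by
  constructor
  · intro h
    by_contra! h'
    exact h (Subtype.ext (by simp [linearForm, h'.1, h'.2]))
  · intro h h0
    have h1 : (C α * X 0 + C β * X 1 : MvPolynomial (Fin 2) ℂ) = 0 := congrArg Subtype.val h0
    have hα := congrArg (eval ![1, 0]) h1
    have hβ := congrArg (eval ![0, 1]) h1
    simp at hα hβ
    tauto

/-- Coordinates of the fourth power of `α t₀ + β t₁`. -/
def powerCoord (α β : ℂ) : Fin 5 → ℂ := ![α ^ 4, α ^ 3 * β, α ^ 2 * β ^ 2, α * β ^ 3, β ^ 4]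

theorem coord_formPow_linearForm (α β : ℂ) :
    coord (formPow 4 (linearForm α β)) = powerCoord α β := by
  have : formPow 4 (linearForm α β) = ofCoord (powerCoord α β) := by
    apply Subtype.ext
    have hm : ∀ (m n : ℕ) (c : ℂ), monomial (Finsupp.single (0 : Fin 2) m + Finsupp.single 1 n) c =
        C c * (X 0 ^ m * X 1 ^ n) := by
      intro m n c
      rw [X_pow_eq_monomial, X_pow_eq_monomial, monomial_mul, C_mul_monomial]
      simp
    simp only [formPow, linearForm, ofCoord, powerCoord, hm, Fin.sum_univ_five]
    simp [Nat.choose, map_ofNat C]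
    ring
  rw [this, coord_ofCoord]

theorem exists_coord_rep_mk (v : Form 4) (hv : v ≠ 0) :
    ∃ c : ℂ, c ≠ 0 ∧ coord (Projectivization.mk ℂ v hv).rep = c • coord v := by
  obtain ⟨c, hc⟩ := (Projectivization.exists_smul_eq_mk_rep ℂ v hv)
  refine ⟨c, c.ne_zero, ?_⟩
  rw [← hc, ← map_smul]
  rfl

theorem eval_smul_of_isHomogeneous {σ : Type*} {f : MvPolynomial σ ℂ} {d : ℕ}
    (hf : f.IsHomogeneous d) (c : ℂ) (a : σ → ℂ) : eval (c • a) f = c ^ d * eval a f := by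
  rw [eval_eq, eval_eq, Finset.mul_sum]
  refine Finset.sum_congr rfl fun m hm => ?_
  have hd : ∑ i ∈ m.support, m i = d := by
    rw [← Finsupp.degree_apply]
    exact (not_imp_comm.1 hf.coeff_eq_zero) (mem_support_iff.1 hm)
  simp only [Pi.smul_apply, smul_eq_mul, mul_pow, Finset.prod_mul_distrib, Finset.prod_pow_eq_pow_sum, hd]
  ring

theorem vanishesAt_mk_iff {f : MvPolynomial (Fin 5) ℂ} {d : ℕ} (hf : f.IsHomogeneous d)
    (v : Form 4) (hv : v ≠ 0) :
    VanishesAt f (Projectivization.mk ℂ v hv) ↔ eval (coord v) f = 0 := by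
  obtain ⟨c, hc, h⟩ := exists_coord_rep_mk v hv
  rw [VanishesAt, h, eval_smul_of_isHomogeneous hf]
  simp [hc]

theorem differential_apply (f : MvPolynomial (Fin 5) ℂ) (x : P 4) (w : Form 4) :
    differential f x w = ∑ i, eval (coord x.rep) (pderiv i f) * coord w i := by
  simp [differential]

/-- Chain rule for a polynomial along a curve. -/
theorem hasDerivAt_eval {σ : Type*} [Fintype σ] {p : ℂ → σ → ℂ} {p' : σ → ℂ} {s : ℂ}
    (hp : ∀ i, HasDerivAt (fun t => p t i) (p' i) s) (f : MvPolynomial σ ℂ) :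
    HasDerivAt (fun t => eval (p t) f) (∑ i, eval (p s) (pderiv i f) * p' i) s := by
  classical
  induction f using MvPolynomial.induction_on with
  | C a => simpa using hasDerivAt_const s a
  | add f g hf hg =>
    simp only [map_add, add_mul, Finset.sum_add_distrib]
    exact hf.fun_add hg
  | mul_X f j hf =>
    simp only [map_mul, eval_X]
    refine (hf.fun_mul (hp j)).congr_deriv ?_
    simp only [Derivation.leibniz, pderiv_X, Pi.single_apply, smul_eq_mul, map_add, map_mul, eval_X,
      apply_ite (eval (p s)), map_zero, add_mul, mul_ite, ite_mul, mul_one, mul_zero,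
      zero_mul, Finset.sum_add_distrib, Finset.sum_ite_eq, Finset.mem_univ, if_true, Finset.sum_mul]
    rw [add_comm]
    congr 1
    exact Finset.sum_congr rfl fun i _ => by ring

/-! ### Quartics with a triple root -/

/-- Coordinates of the product of `(α t₀ + β t₁)³` and `γ t₀ + δ t₁`, multiplied by `4`. -/
def tangentCoord {R : Type*} [CommRing R] (α β γ δ : R) : Fin 5 → R :=
  ![4 * α ^ 3 * γ, 3 * α ^ 2 * β * γ + α ^ 3 * δ, 2 * α * β ^ 2 * γ + 2 * α ^ 2 * β * δ,
    β ^ 3 * γ + 3 * α * β ^ 2 * δ, 4 * β ^ 3 * δ]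

theorem exists_eq_tangentCoord {a : Fin 5 → ℂ} (hC : eval a catalecticant = 0)
    (hQ : eval a quadric = 0) :
    ∃ α β γ δ : ℂ, (α ≠ 0 ∨ β ≠ 0) ∧ a = tangentCoord α β γ δ := by
  simp only [catalecticant, quadric, map_add, map_sub, map_mul, map_pow, eval_X, map_ofNat] at hC hQ
  suffices h : ∃ α β γ δ : ℂ, (α ≠ 0 ∨ β ≠ 0) ∧ a 0 = 4 * α ^ 3 * γ ∧
      a 1 = 3 * α ^ 2 * β * γ + α ^ 3 * δ ∧ a 2 = 2 * α * β ^ 2 * γ + 2 * α ^ 2 * β * δ ∧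
      a 3 = β ^ 3 * γ + 3 * α * β ^ 2 * δ ∧ a 4 = 4 * β ^ 3 * δ by
    obtain ⟨α, β, γ, δ, h, h0, h1, h2, h3, h4⟩ := h
    refine ⟨α, β, γ, δ, h, ?_⟩
    funext i
    fin_cases i <;> simp [tangentCoord, *]
  generalize a 0 = a0 at *
  generalize a 1 = a1 at *
  generalize a 2 = a2 at *
  generalize a 3 = a3 at *
  generalize a 4 = a4 at *
  by_cases h0 : a0 = 0
  · subst h0
    by_cases h1 : a1 = 0
    · subst h1
      have h2 : a2 = 0 := by
        have : a2 ^ 2 = 0 := by linear_combination hQ / 3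
        exact pow_eq_zero_iff (two_ne_zero) |>.1 this
      subst h2
      -- Here `F = t₁^3 (4 a3 t₀ + a4 t₁)`.
      exact ⟨0, 1, a3, a4 / 4, Or.inr one_ne_zero, by ring, by ring, by ring, by ring, by ring⟩
    · have h3 : a3 = 3 * a2 ^ 2 / (4 * a1) := by
        field_simp
        linear_combination -hQ
      have h4 : a4 = a2 ^ 3 / (2 * a1 ^ 2) := by
        have h3' : a1 * a3 = 3 * a2 ^ 2 / 4 := by rw [h3]; field_simp
        field_simp
        linear_combination -2 * hC + 4 * a2 * h3'
      -- `t₁` is a simple factor: `F = 4 a1 t₁ (t₀ + a2 / (2 a1) t₁)^3`.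
      refine ⟨1, a2 / (2 * a1), 0, a1, Or.inl one_ne_zero, by ring, by ring, ?_, ?_, ?_⟩
      · field_simp; ring
      · rw [h3]; field_simp; ring
      · rw [h4]; field_simp; ring
  · -- `s = a1 / a0` kills the second coefficient; then `a2 = -r²`, `a3 = ± 2 r³`.
    obtain ⟨s, rfl⟩ : ∃ s, a1 = a0 * s := ⟨a1 / a0, by field_simp⟩
    obtain ⟨b2, rfl⟩ : ∃ b, a2 = a0 * (b + s ^ 2) := ⟨a2 / a0 - s ^ 2, by field_simp; ring⟩
    obtain ⟨b3, rfl⟩ : ∃ b, a3 = a0 * (b + 3 * s * b2 + s ^ 3) :=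
      ⟨a3 / a0 - 3 * s * b2 - s ^ 3, by field_simp; ring⟩
    obtain ⟨b4, rfl⟩ : ∃ b, a4 = a0 * (b + 4 * s * b3 + 6 * s ^ 2 * b2 + s ^ 4) :=
      ⟨a4 / a0 - 4 * s * b3 - 6 * s ^ 2 * b2 - s ^ 4, by field_simp; ring⟩
    have hQ' : b4 = -3 * b2 ^ 2 := by
      have : a0 ^ 2 * (b4 + 3 * b2 ^ 2) = 0 := by linear_combination hQ
      have := (mul_eq_zero.1 this).resolve_left (pow_ne_zero _ h0)
      linear_combination this
    subst hQ'
    have hC' : b3 ^ 2 = -4 * b2 ^ 3 := by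
      have : a0 ^ 3 * (b3 ^ 2 + 4 * b2 ^ 3) = 0 := by linear_combination -hC
      have := (mul_eq_zero.1 this).resolve_left (pow_ne_zero _ h0)
      linear_combination this
    -- The cuspidal cubic `b3^2 = -4 b2^3` is rational; the sign of the square root `r` of `-b2` is
    -- fixed by `b3`.
    obtain ⟨r, hr, hr3⟩ : ∃ r : ℂ, b2 = -r ^ 2 ∧ b3 = 2 * r ^ 3 := by
      obtain ⟨r, hr⟩ := IsAlgClosed.exists_pow_nat_eq (-b2) two_pos
      have hb : b2 = -r ^ 2 := by linear_combination hr
      have : (b3 - 2 * r ^ 3) * (b3 + 2 * r ^ 3) = 0 := by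
        rw [hb] at hC'
        linear_combination hC'
      rcases mul_eq_zero.1 this with h | h
      · exact ⟨r, hb, by linear_combination h⟩
      · exact ⟨-r, by rw [hb, neg_sq], by linear_combination h⟩
    subst hr hr3
    -- With `u = t₀ + s t₁`, `F / a0 = u^4 - 6 r^2 u^2 t₁^2 + 8 r^3 u t₁^3 - 3 r^4 t₁^4 = (u - r
    -- t₁)^3 (u + 3 r t₁)`.
    exact ⟨1, s - r, a0 / 4, a0 * (s + 3 * r) / 4, Or.inl one_ne_zero,
      by ring, by ring, by ring, by ring, by ring⟩

/-! ### Tangent lines of the Veronese curve -/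

theorem quadric_isHomogeneous : quadric.IsHomogeneous 2 := by
  have hX : ∀ i : Fin 5, (X i : MvPolynomial (Fin 5) ℂ).IsHomogeneous 1 := isHomogeneous_X ℂ
  have h4 : (4 : MvPolynomial (Fin 5) ℂ).IsHomogeneous 0 := isHomogeneous_C _ (4 : ℂ)
  have h3 : (3 : MvPolynomial (Fin 5) ℂ).IsHomogeneous 0 := isHomogeneous_C _ (3 : ℂ)
  exact (((hX 0).mul (hX 4)).sub ((h4.mul (hX 1)).mul (hX 3))).add (h3.mul ((hX 2).pow 2))

theorem catalecticant_isHomogeneous : catalecticant.IsHomogeneous 3 := by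
  have hX : ∀ i : Fin 5, (X i : MvPolynomial (Fin 5) ℂ).IsHomogeneous 1 := isHomogeneous_X ℂ
  have h2 : (2 : MvPolynomial (Fin 5) ℂ).IsHomogeneous 0 := isHomogeneous_C _ (2 : ℂ)
  exact ((((((hX 0).mul (hX 2)).mul (hX 4)).sub ((hX 0).mul ((hX 3).pow 2))).add
    (((h2.mul (hX 1)).mul (hX 2)).mul (hX 3))).sub (((hX 1).pow 2).mul (hX 4))).sub ((hX 2).pow 3)

theorem exists_coord_rep_veronese {x : P 4} (hx : x ∈ veroneseCurve 4) :
    ∃ c α β : ℂ, c ≠ 0 ∧ (α ≠ 0 ∨ β ≠ 0) ∧ coord x.rep = c • powerCoord α β := by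
  obtain ⟨u, rfl⟩ := hx
  induction u using Projectivization.ind with
  | h v hv =>
    obtain ⟨α, β, rfl⟩ := exists_eq_linearForm v
    obtain ⟨c, hc, h⟩ := exists_coord_rep_mk (formPow 4 (linearForm α β)) (formPow_ne_zero 4 hv)
    exact ⟨c, α, β, hc, linearForm_ne_zero.1 hv, by rw [← coord_formPow_linearForm]; exact h⟩

/-- The `2 × 2` minors of the catalecticant matrix vanish on the Veronese curve. -/
theorem minor_vanishesAt {i j k l : Fin 5} (h : (i : ℕ) + j = k + l) {x : P 4}
    (hx : x ∈ veroneseCurve 4) : VanishesAt (X i * X j - X k * X l) x := by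
  obtain ⟨c, α, β, -, -, hr⟩ := exists_coord_rep_veronese hx
  have hp : ∀ i : Fin 5, powerCoord α β i = α ^ (4 - (i : ℕ)) * β ^ (i : ℕ) := by
    intro i
    fin_cases i <;> simp [powerCoord]
  have h' : 4 - (i : ℕ) + (4 - j) = 4 - k + (4 - l) := by omega
  have e : α ^ (4 - (i : ℕ)) * β ^ (i : ℕ) * (α ^ (4 - (j : ℕ)) * β ^ (j : ℕ)) =
      α ^ (4 - (k : ℕ)) * β ^ (k : ℕ) * (α ^ (4 - (l : ℕ)) * β ^ (l : ℕ)) := by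
    rw [mul_mul_mul_comm, ← pow_add, ← pow_add, h', h, pow_add, pow_add, mul_mul_mul_comm]
  rw [VanishesAt, hr]
  simp only [map_sub, map_mul, eval_X, Pi.smul_apply, smul_eq_mul, hp]
  linear_combination c ^ 2 * e

theorem minor_isHomogeneous (i j k l : Fin 5) :
    (X i * X j - X k * X l : MvPolynomial (Fin 5) ℂ).IsHomogeneous 2 :=
  ((isHomogeneous_X ℂ i).mul (isHomogeneous_X ℂ j)).sub
    ((isHomogeneous_X ℂ k).mul (isHomogeneous_X ℂ l))

theorem minor_differential_apply (i j k l : Fin 5) (x : P 4) (w : Form 4) :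
    differential (X i * X j - X k * X l) x w =
      coord x.rep i * coord w j + coord x.rep j * coord w i -
        (coord x.rep k * coord w l + coord x.rep l * coord w k) := by
  rw [differential_apply]
  simp only [map_sub, Derivation.leibniz, pderiv_X, Pi.single_apply, smul_eq_mul, map_add,
    eval_X, apply_ite (eval (coord x.rep)), map_zero, add_mul, sub_mul, mul_ite, ite_mul,
    mul_one, mul_zero, zero_mul, Finset.sum_add_distrib, Finset.sum_sub_distrib, Finset.sum_ite_eq,
    Finset.mem_univ, if_true]

theorem tangentialSurface_subset :
    tangentialSurface ⊆ zeroLocus catalecticant ∩ zeroLocus quadric := by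
  intro y hy
  obtain ⟨x, hx, hy⟩ := Set.mem_iUnion₂.1 hy
  obtain ⟨c, α, β, hc, hαβ, hr⟩ := exists_coord_rep_veronese hx
  have key : ∀ i j k l : Fin 5, (i : ℕ) + j = k + l →
      powerCoord α β i * coord y.rep j + powerCoord α β j * coord y.rep i -
        (powerCoord α β k * coord y.rep l + powerCoord α β l * coord y.rep k) = 0 := by
    intro i j k l h
    have := hy 2 _ (minor_isHomogeneous i j k l) fun z hz => minor_vanishesAt h hz
    rw [minor_differential_apply, hr] at this
    simp only [Pi.smul_apply, smul_eq_mul] at this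
    refine (mul_eq_zero.1 (?_ : c * _ = 0)).resolve_left hc
    linear_combination this
  simp only [zeroLocus, Set.mem_inter_iff, Set.mem_ofPred_eq, VanishesAt, catalecticant, quadric,
    map_add, map_sub, map_mul, map_pow, eval_X, map_ofNat]
  by_cases hα : α = 0
  · have hβ : β ^ 4 ≠ 0 := pow_ne_zero _ (hαβ.resolve_left (by simp [hα]))
    -- At the point `t₁^4` the tangent line is `a₀ = a₁ = a₂ = 0`.
    have k1 := key 4 2 3 3 rfl
    have k2 := key 4 1 2 3 rfl
    have k3 := key 4 0 2 2 rfl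
    simp [powerCoord, hα, hβ] at k1 k2 k3
    simp [k1, k2, k3]
  · obtain ⟨t, rfl⟩ : ∃ t, β = α * t := ⟨β / α, by field_simp⟩
    -- These three linear equations determine `a₂, a₃, a₄` from `a₀, a₁`, so they already cut out a
    -- line, on which `C` and `Q` vanish identically.
    have k1 := key 0 2 1 1 rfl
    have k2 := key 0 3 1 2 rfl
    have k3 := key 0 4 2 2 rfl
    simp [powerCoord] at k1 k2 k3
    have hα4 := pow_ne_zero 4 hα
    have e2 : coord y.rep 2 = 2 * t * coord y.rep 1 - t ^ 2 * coord y.rep 0 :=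
      mul_left_cancel₀ hα4 (by linear_combination k1)
    have e3 : coord y.rep 3 = t * coord y.rep 2 + t ^ 2 * coord y.rep 1 - t ^ 3 * coord y.rep 0 :=
      mul_left_cancel₀ hα4 (by linear_combination k2)
    have e4 : coord y.rep 4 = 2 * t ^ 2 * coord y.rep 2 - t ^ 4 * coord y.rep 0 :=
      mul_left_cancel₀ hα4 (by linear_combination k3)
    rw [e4, e3, e2]
    constructor <;> ring

theorem eval_powerCoord_eq_zero {f : MvPolynomial (Fin 5) ℂ} {d : ℕ} (hf : f.IsHomogeneous d)
    (hX : ∀ z ∈ veroneseCurve 4, VanishesAt f z) {α β : ℂ} (h : α ≠ 0 ∨ β ≠ 0) :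
    eval (powerCoord α β) f = 0 := by
  have hv := linearForm_ne_zero.2 h
  have := hX _ ⟨Projectivization.mk ℂ _ hv, rfl⟩
  rw [← coord_formPow_linearForm]
  exact (vanishesAt_mk_iff hf _ (formPow_ne_zero 4 hv)).1 this

/-- The sum is the derivative at `t = 0` of `f` along the curve `(v + t w)^4`, where `f` is
identically zero. -/
theorem sum_pderiv_tangentCoord_eq_zero {f : MvPolynomial (Fin 5) ℂ} {d : ℕ}
    (hf : f.IsHomogeneous d) (hX : ∀ z ∈ veroneseCurve 4, VanishesAt f z) {α β : ℂ}
    (h : α ≠ 0 ∨ β ≠ 0) (γ δ : ℂ) :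
    ∑ i, eval (powerCoord α β) (pderiv i f) * tangentCoord α β γ δ i = 0 := by
  have hl : ∀ a b : ℂ, HasDerivAt (fun t : ℂ => a + t * b) b 0 := fun a b => by
    simpa using ((hasDerivAt_id (0 : ℂ)).mul_const b).const_add a
  have hp : ∀ i, HasDerivAt (fun t => powerCoord (α + t * γ) (β + t * δ) i)
      (tangentCoord α β γ δ i) 0 := by
    intro i
    have hα := hl α γ
    have hβ := hl β δ
    fin_cases i
    · refine (hα.pow 4).congr_deriv ?_
      simp [tangentCoord]
    · refine ((hα.pow 3).mul hβ).congr_deriv ?_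
      simp [tangentCoord]; ring
    · refine ((hα.pow 2).mul (hβ.pow 2)).congr_deriv ?_
      simp [tangentCoord]; ring
    · refine (hα.mul (hβ.pow 3)).congr_deriv ?_
      simp [tangentCoord]; ring
    · refine (hβ.pow 4).congr_deriv ?_
      simp [tangentCoord]
  have hd := hasDerivAt_eval hp f
  simp only [zero_mul, add_zero] at hd
  refine hd.unique ((hasDerivAt_const (0 : ℂ) (0 : ℂ)).congr_of_eventuallyEq ?_)
  -- The vanishing of `f` is known only at points of projective space, so `v + t w` has to be
  -- nonzero; this holds for small `t`.
  have hne : ∀ᶠ t : ℂ in nhds 0, α + t * γ ≠ 0 ∨ β + t * δ ≠ 0 := by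
    rcases h with h | h
    · exact ((hl α γ).continuousAt.eventually_ne (by simpa using h)).mono fun _ => Or.inl
    · exact ((hl β δ).continuousAt.eventually_ne (by simpa using h)).mono fun _ => Or.inr
  exact hne.mono fun t ht => eval_powerCoord_eq_zero hf hX ht

theorem subset_tangentialSurface :
    zeroLocus catalecticant ∩ zeroLocus quadric ⊆ tangentialSurface := by
  rintro y ⟨hC, hQ⟩
  obtain ⟨α, β, γ, δ, h, hy⟩ := exists_eq_tangentCoord hC hQ
  have hv := linearForm_ne_zero.2 h
  refine Set.mem_iUnion₂.2 ⟨_, ⟨Projectivization.mk ℂ _ hv, rfl⟩, fun d f hf hX => ?_⟩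
  obtain ⟨c, hc, hr⟩ := exists_coord_rep_mk _ (formPow_ne_zero 4 hv)
  change coord (veronese 4 (Projectivization.mk ℂ _ hv)).rep = _ at hr
  rw [differential_apply, hr, coord_formPow_linearForm, hy]
  have hs := sum_pderiv_tangentCoord_eq_zero hf hX h γ δ
  -- Changing the representative scales all partial derivatives by the same power of `c`.
  simp only [eval_smul_of_isHomogeneous hf.pderiv, mul_assoc, ← Finset.mul_sum, hs, mul_zero]

/-! ### Generic transversality -/

theorem ker_sup_ker_eq_top {K V : Type*} [Field K] [AddCommGroup V] [Module K V]
    {φ ψ : V →ₗ[K] K} {e : V} (hφ : φ e = 0) (hψ : ψ e ≠ 0) :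
    LinearMap.ker φ ⊔ LinearMap.ker ψ = ⊤ := by
  refine eq_top_iff.2 fun w _ => Submodule.mem_sup.2
    ⟨(ψ w / ψ e) • e, by simp [hφ], w - (ψ w / ψ e) • e, ?_, by abel⟩
  simp [hψ]

/-- The minor of the Jacobian matrix of `(C, Q)` in the last two coordinates. -/
noncomputable def jacobianMinor : MvPolynomial (Fin 5) ℂ :=
  pderiv 3 catalecticant * pderiv 4 quadric - pderiv 4 catalecticant * pderiv 3 quadric

theorem jacobianMinor_isHomogeneous : jacobianMinor.IsHomogeneous 3 :=
  (catalecticant_isHomogeneous.pderiv.mul quadric_isHomogeneous.pderiv).sub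
    (catalecticant_isHomogeneous.pderiv.mul quadric_isHomogeneous.pderiv)

theorem transverseAt_of_jacobianMinor {x : P 4} (hC : VanishesAt catalecticant x)
    (hQ : VanishesAt quadric x) (hJ : ¬ VanishesAt jacobianMinor x) :
    TransverseAt catalecticant quadric x := by
  simp only [VanishesAt, jacobianMinor, map_sub, map_mul] at hJ
  set φ := fun i => eval (coord x.rep) (pderiv i catalecticant) with hφ
  set ψ := fun i => eval (coord x.rep) (pderiv i quadric) with hψ
  let e (a b : ℂ) : Form 4 := ofCoord ![0, 0, 0, a, b]
  have hde : ∀ f a b, differential f x (e a b) =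
      eval (coord x.rep) (pderiv 3 f) * a + eval (coord x.rep) (pderiv 4 f) * b := by
    intro f a b
    rw [differential_apply, coord_ofCoord]
    simp [Fin.sum_univ_five]
  -- The vector `(-C₄, C₃)` in the last two coordinates is killed by `dC`, while `dQ` takes the
  -- value of the minor on it; `(Q₄, -Q₃)` then shows that `dC ≠ 0`.
  have h1 : differential catalecticant x (e (-φ 4) (φ 3)) = 0 := by rw [hde]; ring
  have h2 : differential quadric x (e (-φ 4) (φ 3)) ≠ 0 := by
    rw [hde]
    convert hJ using 1
    ring
  have h3 : differential catalecticant x (e (ψ 4) (-ψ 3)) ≠ 0 := by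
    rw [hde]
    convert hJ using 1
    ring
  exact ⟨hC, hQ, fun h => h3 (by rw [h]; rfl), fun h => h2 (by rw [h]; rfl),
    ker_sup_ker_eq_top h1 h2⟩

theorem eval_tangentCoord_quadric (α β γ δ : ℂ) : eval (tangentCoord α β γ δ) quadric = 0 := by
  simp [tangentCoord, quadric]
  ring

theorem eval_tangentCoord_catalecticant (α β γ δ : ℂ) :
    eval (tangentCoord α β γ δ) catalecticant = 0 := by
  simp [tangentCoord, catalecticant]
  ring

theorem eval_jacobianMinor (a : Fin 5 → ℂ) : eval a jacobianMinor =
    (2 * a 1 * a 2 - 2 * a 0 * a 3) * a 0 - 4 * (a 0 * a 2 - a 1 ^ 2) * a 1 * (-1) := by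
  simp [jacobianMinor, catalecticant, quadric, Derivation.leibniz, Derivation.leibniz_pow, pderiv_X,
    ← map_ofNat (C : ℂ →+* MvPolynomial (Fin 5) ℂ)]
  ring

/-- Pulled back to the parameters, `f` times the Jacobian minor is zero at every point: either the
minor vanishes, or the point is transverse and `f` vanishes. The polynomial ring is a domain and the
minor pulls back to a nonzero polynomial, so `f` pulls back to zero. -/
theorem eval_tangentCoord_eq_zero {f : MvPolynomial (Fin 5) ℂ} {d : ℕ} (hf : f.IsHomogeneous d)
    (hT : ∀ z ∈ {x | TransverseAt catalecticant quadric x}, VanishesAt f z) (α β γ δ : ℂ) :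
    eval (tangentCoord α β γ δ) f = 0 := by
  -- the generic tangent vector, with the four parameters as variables
  let T : Fin 5 → MvPolynomial (Fin 4) ℂ := tangentCoord (X 0) (X 1) (X 2) (X 3)
  have heval : ∀ (g : MvPolynomial (Fin 5) ℂ) (u : Fin 4 → ℂ),
      eval u (bind₁ T g) = eval (tangentCoord (u 0) (u 1) (u 2) (u 3)) g := by
    intro g u
    have : (fun i => eval u (T i)) = tangentCoord (u 0) (u 1) (u 2) (u 3) := by
      funext i
      fin_cases i <;> simp [T, tangentCoord]
    rw [← this]
    exact eval₂Hom_bind₁ _ _ _ _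
  have hmul : bind₁ T f * bind₁ T jacobianMinor = 0 := by
    refine MvPolynomial.funext fun u => ?_
    rw [map_mul, map_zero, heval, heval]
    set a := tangentCoord (u 0) (u 1) (u 2) (u 3) with ha
    by_cases hJ : eval a jacobianMinor = 0
    · rw [hJ, mul_zero]
    have hne : ofCoord a ≠ 0 := by
      intro h0
      have h0' : a = 0 := by rw [← coord_ofCoord a, h0, map_zero]
      exact hJ (by rw [h0', eval_jacobianMinor]; simp)
    have hmk : ∀ {g : MvPolynomial (Fin 5) ℂ} {n : ℕ}, g.IsHomogeneous n →
        (VanishesAt g (Projectivization.mk ℂ _ hne) ↔ eval a g = 0) := fun hg => by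
      rw [vanishesAt_mk_iff hg, coord_ofCoord]
    have hx := transverseAt_of_jacobianMinor
      ((hmk catalecticant_isHomogeneous).2 (eval_tangentCoord_catalecticant _ _ _ _))
      ((hmk quadric_isHomogeneous).2 (eval_tangentCoord_quadric _ _ _ _))
      (fun h => hJ ((hmk jacobianMinor_isHomogeneous).1 h))
    rw [(hmk hf).1 (hT _ hx), zero_mul]
  have hJ : bind₁ T jacobianMinor ≠ 0 := by
    intro h
    -- The quartic `4 t₀^3 t₁`, with `a₁ = 1` as its only nonzero coordinate, is a point where the
    -- minor does not vanish.
    have := heval jacobianMinor ![1, 0, 0, 1]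
    rw [h, eval_jacobianMinor] at this
    simp [tangentCoord] at this
  have := heval f ![α, β, γ, δ]
  rw [(mul_eq_zero.1 hmul).resolve_right hJ] at this
  simpa using this.symm

theorem genericallyTransverse_catalecticant_quadric :
    GenericallyTransverse catalecticant quadric := by
  rintro x ⟨hC, hQ⟩ d f hf hT
  obtain ⟨α, β, γ, δ, -, hx⟩ := exists_eq_tangentCoord hC hQ
  rw [VanishesAt, hx]
  exact eval_tangentCoord_eq_zero hf hT α β γ δ

/-! ### The pencil and its base locus -/

theorem jPencil_eq_span : jPencil = Submodule.span ℂ {quadric ^ 3, catalecticant ^ 2} := by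
  have hD : discriminant = quadric ^ 3 - (27 : ℂ) • catalecticant ^ 2 := by
    rw [discriminant, smul_eq_C_mul, map_ofNat]
  apply le_antisymm
  · refine Submodule.span_le.2 (Set.pair_subset (Submodule.subset_span (by simp)) ?_)
    rw [hD]
    exact Submodule.sub_mem _ (Submodule.subset_span (by simp))
      (Submodule.smul_mem _ _ (Submodule.subset_span (by simp)))
  · refine Submodule.span_le.2 (Set.pair_subset (Submodule.subset_span (by simp)) ?_)
    have : catalecticant ^ 2 = (27 : ℂ)⁻¹ • (quadric ^ 3 - discriminant) := by
      rw [hD, sub_sub_cancel, smul_smul, inv_mul_cancel₀ (by norm_num), one_smul]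
    rw [this]
    exact Submodule.smul_mem _ _ (Submodule.sub_mem _ (Submodule.subset_span (by simp))
      (Submodule.subset_span (by simp)))

theorem baseLocus_span_pair (f g : MvPolynomial (Fin 5) ℂ) :
    baseLocus (Submodule.span ℂ {f, g}) = zeroLocus f ∩ zeroLocus g := by
  ext x
  refine ⟨fun h => ⟨h f (Submodule.subset_span (by simp)), h g (Submodule.subset_span (by simp))⟩,
    fun h p hp => ?_⟩
  obtain ⟨a, b, rfl⟩ := Submodule.mem_span_pair.1 hp
  have hf : eval (coord x.rep) f = 0 := h.1
  have hg : eval (coord x.rep) g = 0 := h.2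
  simp [VanishesAt, smul_eval, hf, hg]

theorem zeroLocus_pow (f : MvPolynomial (Fin 5) ℂ) {n : ℕ} (hn : n ≠ 0) :
    zeroLocus (f ^ n) = zeroLocus f := by
  ext x
  simp [zeroLocus, VanishesAt, hn]

end BinaryQuartic

theorem mainTheorem1 :
    BinaryQuartic.tangentialSurface =
        BinaryQuartic.zeroLocus BinaryQuartic.catalecticant ∩
          BinaryQuartic.zeroLocus BinaryQuartic.quadric ∧
      BinaryQuartic.GenericallyTransverse BinaryQuartic.catalecticant BinaryQuartic.quadric ∧
      BinaryQuartic.jPencil =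
        Submodule.span ℂ {BinaryQuartic.quadric ^ 3, BinaryQuartic.catalecticant ^ 2} ∧
      BinaryQuartic.baseLocus BinaryQuartic.jPencil = BinaryQuartic.tangentialSurface := by
  have hT := Set.Subset.antisymm BinaryQuartic.tangentialSurface_subset
    BinaryQuartic.subset_tangentialSurface
  refine ⟨hT, BinaryQuartic.genericallyTransverse_catalecticant_quadric,
    BinaryQuartic.jPencil_eq_span, ?_⟩
  rw [BinaryQuartic.jPencil_eq_span, BinaryQuartic.baseLocus_span_pair,
    BinaryQuartic.zeroLocus_pow _ three_ne_zero, BinaryQuartic.zeroLocus_pow _ two_ne_zero, hT,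
    Set.inter_comm]
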